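/- Let $p=2$ and let $A=\mathbb Z\{X,Y\}$ be the ring of polynomials in two non-commuting variables; write $\mathbb N_0=\{0,1,2,\dots\}$. Let $W(A)=\varprojlim_n W_n(A)$ be Hesselholt's topological abelian group of $p$-typical Witt vectors, where each $W_n(A)$ is discrete (since $A/[A,A]$ has no $p$-torsion, $W_n(A)$ is identified with the image of the ghost map $A^n\to (A/[A,A])^n$, $(a_0,\dots,a_{n-1})\mapsto \big(\sum_{j\le i}p^ja_j^{p^{i-j}}\big)_{0\le i<n}$), with $V(a_0,a_1,\dots)=(0,a_0,a_1,\dots)$ and $\langle a\rangle=(a,0,0,\dots)$. For a ring $R$, give $R^{\mathbb N_0}$ the product of the discrete topologies, and put $\langle a\rangle=(a,a^p,a^{p^2},\dots)$ and $V(x_0,x_1,\dots)=p(0,x_0,x_1,\dots)$. For an ideal $J\subseteq R$ (possibly $J=R$), let $X(J)$ be the closed subgroup of $R^{\mathbb N_0}$ generated by all $V^m(\langle a_1\rangle\cdots\langle a_r\rangle)$ with $m\ge 0$, $r\ge 1$, $a_i\in J$. Let $\mathbb ZA$ be the monoid algebra of the multiplicative monoid of $A$ and $I$ the kernel of $\mathbb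 ZA\to A$, $[a]\mapsto a$. Let $E(A)=X(\mathbb ZA)/X(I)$ with the quotient topology (the construction of Cuntz and Deninger), with the induced map $V:E(A)\to E(A)$ and with $\langle a\rangle\in E(A)$ the class of $\langle [a]\rangle$, for $a\in A$. Let $HH_0(E(A))=E(A)/\overline{[E(A),E(A)]}$ with the quotient topology, where $[E(A),E(A)]$ is the additive subgroup generated by the commutators (that is, by the classes of the $xy-yx$ with $x,y\in X(\mathbb ZA)$), and let $\pi:E(A)\to HH_0(E(A))$ be the quotient map. A subset of a topological abelian group generates it topologically if the subgroup that it generates is dense. Then: (i) $W(A)$ is topologically generated by $\{V^n\langle a\rangle \mid n\in\mathbb N_0,\ a\in A\}$. (ii) $HH_0(E(A))$ is not topologically generated by $\{\pi(V^n\langle a\rangle)\mid n\in\mathbb N_0,\ a\in A\}$. More precisely, the class in $HH_0(E(A))$ of $\langle [X]\rangle\langle [Y]\rangle\in X(\mathbb ZA)$ is not in the closure of the subgroup generated by these elements. (iii) There is no continuous surjective map $f:W(A)\to HH_0(E(A))$ which commutes with $V$ and satisfies $f(\langle a\rangle)=\pi(\langle a\rangle)$ for all $a\in A$. Here $f$ commutes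 with $V$ if for every $w\in W(A)$ there is an $e\in E(A)$ with $\pi(e)=f(w)$ and $\pi(V(e))=f(V(w))$. -/

import Mathlib

namespace NCWitt

/-! ### The image of the ghost map is a subgroup -/

/-- The shift of an infinite word in two letters. -/
def wordShift (t : ℕ → Bool) : ℕ → Bool := fun i => t (i + 1)

/-- The product of the first `m` letters of a word. -/
def wordProd {R : Type*} [Ring R] (x : Bool → R) (m : ℕ) (t : ℕ → Bool) : R :=
  ((List.range m).map fun i => x (t i)).prod

/-- The additive subgroup `[R, R]` generated by the commutators. -/
def commSub (R : Type*) [Ring R] : AddSubgroup R :=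
  AddSubgroup.closure {z | ∃ x y : R, z = x * y - y * x}

/-- The class of an element of `R` in `R / [R, R]`. -/
def tr {R : Type*} [Ring R] : R →+ R ⧸ commSub R := QuotientAddGroup.mk' (commSub R)

theorem tr_mul_comm {R : Type*} [Ring R] (x y : R) : tr (x * y) = tr (y * x) := by
  rw [← sub_eq_zero, ← map_sub]
  exact (QuotientAddGroup.eq_zero_iff _).2 (AddSubgroup.subset_closure ⟨x, y, rfl⟩)

theorem add_pow_eq_sum_words {R : Type*} [Ring R] (x : Bool → R) (m : ℕ) :
    (x true + x false) ^ m = ∑ u : Fin m → Bool, (List.ofFn fun i => x (u i)).prod := by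
  induction m with
  | zero => simp
  | succ m ih =>
    rw [pow_succ', ih, ← Fintype.sum_equiv (Fin.consEquiv fun _ : Fin (m + 1) => Bool)
      (fun q => x q.1 * (List.ofFn fun i => x (q.2 i)).prod) _ (fun q => by simp [Fin.consEquiv]),
      Fintype.sum_prod_type, Fintype.sum_bool, add_mul, Finset.mul_sum, Finset.mul_sum]

theorem wordShift_iterate (m : ℕ) (t : ℕ → Bool) : wordShift^[m] t = fun i => t (i + m) := by
  induction m generalizing t with
  | zero => rfl
  | succ m ih => rw [Function.iterate_succ_apply, ih]; funext i; simp only [wordShift]; congr 1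

theorem isPeriodicPt_wordShift {m : ℕ} {t : ℕ → Bool} :
    Function.IsPeriodicPt wordShift m t ↔ ∀ i, t (i + m) = t i := by
  rw [Function.IsPeriodicPt, Function.IsFixedPt, wordShift_iterate, funext_iff]

theorem tr_wordProd_shift {R : Type*} [Ring R] (x : Bool → R) {m : ℕ} {t : ℕ → Bool}
    (h : Function.IsPeriodicPt wordShift m t) :
    tr (wordProd x m (wordShift t)) = tr (wordProd x m t) := by
  rcases m with _ | m
  · simp [wordProd]
  · have h0 := isPeriodicPt_wordShift.1 h 0
    have e1 : wordProd x (m + 1) (wordShift t) =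
        ((List.range m).map fun i => x (t (i + 1))).prod * x (t 0) := by
      rw [wordProd, List.range_succ, List.map_append, List.prod_append]
      simp only [zero_add] at h0
      simp [wordShift, h0]
    have e2 : wordProd x (m + 1) t =
        x (t 0) * ((List.range m).map fun i => x (t (i + 1))).prod := by
      rw [wordProd, List.range_succ_eq_map, List.map_cons, List.prod_cons, List.map_map]
      rfl
    rw [e1, e2, tr_mul_comm]

theorem wordProd_mul {R : Type*} [Ring R] (x : Bool → R) {m : ℕ} {t : ℕ → Bool}
    (h : Function.IsPeriodicPt wordShift m t) (r : ℕ) :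
    wordProd x (m * r) t = wordProd x m t ^ r := by
  induction r with
  | zero => simp [wordProd]
  | succ r ih =>
    have hp := isPeriodicPt_wordShift.1 (h.mul_const r)
    rw [pow_succ, ← ih, wordProd, wordProd, wordProd, Nat.mul_succ, List.range_add,
      List.map_append, List.prod_append, List.map_map]
    congr 3
    funext i
    simp only [Function.comp]
    rw [add_comm, hp]

/-- The words of period `m`. -/
noncomputable def perWords (m : ℕ) [NeZero m] : Finset (ℕ → Bool) := by
  classical
  exact Finset.univ.image fun (u : Fin m → Bool) (i : ℕ) => u (Fin.ofNat m i)

theorem mem_perWords {m : ℕ} [NeZero m] {t : ℕ → Bool} :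
    t ∈ perWords m ↔ Function.IsPeriodicPt wordShift m t := by
  classical
  rw [isPeriodicPt_wordShift]
  simp only [perWords, Finset.mem_image, Finset.mem_univ, true_and]
  constructor
  · rintro ⟨u, rfl⟩ i
    simp [Fin.ofNat]
  · intro h
    refine ⟨fun i => t i, ?_⟩
    funext i
    exact Function.Periodic.map_mod_nat h i

theorem add_pow_eq_sum_perWords {R : Type*} [Ring R] (x : Bool → R) (m : ℕ) [NeZero m] :
    (x true + x false) ^ m = ∑ t ∈ perWords m, wordProd x m t := by
  classical
  rw [add_pow_eq_sum_words, perWords, Finset.sum_image]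
  · refine Finset.sum_congr rfl fun u _ => ?_
    rw [wordProd, List.ofFn_eq_map, ← List.map_coe_finRange_eq_range, List.map_map]
    congr 2
    funext i
    simp
  · intro u _ v _ h
    funext i
    simpa using congrFun h i

/-- A sum of a shift-invariant function over words of exact period `m` is `m` times a sum over
representatives. -/
theorem exists_reps (m : ℕ) (S : Finset (ℕ → Bool))
    (hS : ∀ t ∈ S, wordShift t ∈ S ∧ Function.minimalPeriod wordShift t = m) (hm : 0 < m) :
    ∃ U ⊆ S, ∀ {M : Type*} [AddCommGroup M] (f : (ℕ → Bool) → M),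
      (∀ t ∈ S, f (wordShift t) = f t) → ∑ t ∈ S, f t = m • ∑ t ∈ U, f t := by
  classical
  induction S using Finset.strongInduction with
  | H S ih =>
    rcases S.eq_empty_or_nonempty with rfl | ⟨t, ht⟩
    · exact ⟨∅, by simp, by simp⟩
    have hit : ∀ j, wordShift^[j] t ∈ S := by
      intro j
      induction j with
      | zero => exact ht
      | succ j ihj => rw [Function.iterate_succ_apply']; exact (hS _ ihj).1
    have hmt := (hS t ht).2
    have hper : wordShift^[m] t = t := by
      have := Function.isPeriodicPt_minimalPeriod wordShift t
      rwa [hmt] at this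
    set O := (Finset.range m).image fun j => wordShift^[j] t with hO
    have hinj : Set.InjOn (fun j => wordShift^[j] t) (Finset.range m : Set ℕ) := by
      have := Function.iterate_injOn_Iio_minimalPeriod (f := wordShift) (x := t)
      rw [hmt] at this
      intro i hi j hj
      exact this (by simpa using hi) (by simpa using hj)
    have hOS : O ⊆ S := by
      intro y hy
      obtain ⟨j, -, rfl⟩ := Finset.mem_image.1 hy
      exact hit j
    have htO : t ∈ O := Finset.mem_image.2 ⟨0, by simpa using hm, rfl⟩
    have hback : ∀ y ∈ S, wordShift y ∈ O → y ∈ O := by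
      intro y hy h
      obtain ⟨j, -, hj⟩ := Finset.mem_image.1 h
      have hyp : wordShift^[m] y = y := by
        have := Function.isPeriodicPt_minimalPeriod wordShift y
        rwa [(hS y hy).2] at this
      have e : y = wordShift^[m - 1 + j] t := by
        rw [Function.iterate_add_apply, hj, ← Function.iterate_succ_apply,
          Nat.succ_eq_add_one, Nat.sub_add_cancel hm, hyp]
      refine Finset.mem_image.2 ⟨(m - 1 + j) % m, by simpa using Nat.mod_lt _ hm, ?_⟩
      rw [e]
      exact Function.IsPeriodicPt.iterate_mod_apply hper _
    obtain ⟨U, hU, hf⟩ := ih (S \ O) (Finset.sdiff_ssubset hOS ⟨t, htO⟩) (by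
      intro y hy
      rw [Finset.mem_sdiff] at hy
      refine ⟨Finset.mem_sdiff.2 ⟨(hS y hy.1).1, fun h => hy.2 (hback y hy.1 h)⟩, (hS y hy.1).2⟩)
    have htU : t ∉ U := fun h => (Finset.mem_sdiff.1 (hU h)).2 htO
    refine ⟨insert t U, ?_, ?_⟩
    · intro y hy
      rcases Finset.mem_insert.1 hy with rfl | hy
      · exact ht
      · exact (Finset.mem_sdiff.1 (hU hy)).1
    · intro M _ f hinv
      have hfit : ∀ j, f (wordShift^[j] t) = f t := by
        intro j
        induction j with
        | zero => rfl
        | succ j ihj => rw [Function.iterate_succ_apply', hinv _ (hit j), ihj]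
      rw [Finset.sum_insert htU, smul_add, ← hf f fun y hy => hinv y (Finset.mem_sdiff.1 hy).1,
        ← Finset.sum_sdiff hOS, add_comm, hO, Finset.sum_image hinj]
      simp [hfit]


theorem sum_perWords_prime_pow (p : ℕ) [hp : Fact p.Prime] {M : Type*} [AddCommGroup M]
    (f : (ℕ → Bool) → M) (n : ℕ) :
    ∑ t ∈ perWords (p ^ n), f t = ∑ t ∈ perWords (p ^ 0), f t + ∑ k ∈ Finset.range n,
      ∑ t ∈ perWords (p ^ (k + 1)) with Function.minimalPeriod wordShift t = p ^ (k + 1), f t := by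
  induction n with
  | zero => simp
  | succ n ih =>
    rw [Finset.sum_range_succ, ← add_assoc, ← ih, add_comm (∑ t ∈ perWords (p ^ n), f t),
      ← Finset.sum_filter_add_sum_filter_not (perWords (p ^ (n + 1)))
        (fun t => Function.minimalPeriod wordShift t = p ^ (n + 1))]
    congr 1
    refine Finset.sum_congr ?_ fun _ _ => rfl
    ext t
    rw [Finset.mem_filter, mem_perWords, mem_perWords,
      Function.isPeriodicPt_iff_minimalPeriod_dvd, Function.isPeriodicPt_iff_minimalPeriod_dvd]
    constructor
    · rintro ⟨h1, h2⟩
      obtain ⟨k, hk, e⟩ := (Nat.dvd_prime_pow hp.out).1 h1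
      rw [e] at h2 ⊢
      have : k ≠ n + 1 := fun h => h2 (by rw [h])
      exact pow_dvd_pow p (by omega)
    · intro h
      refine ⟨h.trans (pow_dvd_pow p n.le_succ), fun h2 => ?_⟩
      rw [h2] at h
      have := (Nat.pow_dvd_pow_iff_le_right hp.out.one_lt).1 h
      omega

/-- Expansion of `(a + b) ^ (p ^ n)` modulo commutators along necklaces. -/
theorem necklace_expansion (p : ℕ) [hp : Fact p.Prime] {R : Type*} [Ring R] (a b : R) :
    ∃ U : ℕ → Multiset R, ∀ n : ℕ, tr ((a + b) ^ p ^ n) = tr (a ^ p ^ n) + tr (b ^ p ^ n) +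
      ∑ k ∈ Finset.range n,
        p ^ (k + 1) • ((U k).map fun u => tr (u ^ p ^ (n - (k + 1)))).sum := by
  classical
  set x : Bool → R := fun s => cond s a b with hx
  have hreps : ∀ k : ℕ, ∃ U ⊆ (perWords (p ^ (k + 1))).filter
      (fun t => Function.minimalPeriod wordShift t = p ^ (k + 1)),
      ∀ f : (ℕ → Bool) → R ⧸ commSub R,
      (∀ t ∈ (perWords (p ^ (k + 1))).filter
        (fun t => Function.minimalPeriod wordShift t = p ^ (k + 1)), f (wordShift t) = f t) →
      ∑ t ∈ perWords (p ^ (k + 1)) with Function.minimalPeriod wordShift t = p ^ (k + 1), f t =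
        p ^ (k + 1) • ∑ t ∈ U, f t := by
    intro k
    obtain ⟨U, hU, h⟩ := exists_reps (p ^ (k + 1)) ((perWords (p ^ (k + 1))).filter
      (fun t => Function.minimalPeriod wordShift t = p ^ (k + 1))) (by
        intro t ht
        rw [Finset.mem_filter, mem_perWords] at ht
        have hm : Function.minimalPeriod wordShift (wordShift t) = p ^ (k + 1) := by
          rw [Function.minimalPeriod_apply ⟨_, pow_pos hp.out.pos _, ht.1⟩, ht.2]
        refine ⟨Finset.mem_filter.2 ⟨mem_perWords.2 ?_, hm⟩, ht.2⟩
        rw [Function.isPeriodicPt_iff_minimalPeriod_dvd, hm]) (pow_pos hp.out.pos _)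
    exact ⟨U, hU, fun f hf => h f hf⟩
  choose U hU hUf using hreps
  refine ⟨fun k => (U k).val.map (wordProd x (p ^ (k + 1))), fun n => ?_⟩
  have h1 : (a + b) ^ p ^ n = ∑ t ∈ perWords (p ^ n), wordProd x (p ^ n) t :=
    add_pow_eq_sum_perWords x (p ^ n)
  rw [h1, map_sum, sum_perWords_prime_pow]
  congr 1
  · have h2 := add_pow_eq_sum_perWords (fun s => x s ^ p ^ n) (p ^ 0)
    simp only [pow_zero, pow_one] at h2 ⊢
    rw [← map_add, ← map_sum]
    change tr _ = tr (x true ^ p ^ n + x false ^ p ^ n)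
    rw [h2]
    congr 1
    refine Finset.sum_congr rfl fun t ht => ?_
    have := wordProd_mul x (mem_perWords.1 ht) (p ^ n)
    rw [one_mul] at this
    rw [this]
    simp [wordProd]
  · refine Finset.sum_congr rfl fun k hk => ?_
    have hkn : p ^ n = p ^ (k + 1) * p ^ (n - (k + 1)) := by
      rw [← pow_add, Nat.add_sub_cancel' (Finset.mem_range.1 hk)]
    rw [hUf k]
    · congr 1
      rw [Multiset.map_map]
      change _ = ∑ t ∈ U k, _
      refine Finset.sum_congr rfl fun t ht => ?_
      have ht' := mem_perWords.1 (Finset.mem_filter.1 (hU k ht)).1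
      rw [hkn, wordProd_mul x ht']
      rfl
    · intro t ht
      have ht' := mem_perWords.1 (Finset.mem_filter.1 ht).1
      refine tr_wordProd_shift x ?_
      rw [hkn]
      exact ht'.mul_const _

/-- The Witt polynomial `a₀ ^ (p ^ i) + p a₁ ^ (p ^ (i - 1)) + ⋯ + p ^ i aᵢ`. -/
def wittPoly (p : ℕ) {R : Type*} [Ring R] {n : ℕ} (a : Fin n → R) (i : Fin n) : R :=
  ∑ j : Fin (i.1 + 1), (p : R) ^ (j : ℕ) * a (Fin.castLE i.2 j) ^ p ^ (i.1 - j.1)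

/-- The ghost map `Rⁿ → (R / [R, R])ⁿ`. -/
def ghost (p : ℕ) {R : Type*} [Ring R] {n : ℕ} (a : Fin n → R) : Fin n → R ⧸ commSub R :=
  fun i => tr (wittPoly p a i)

theorem tr_mul_natCast_pow (p k : ℕ) {R : Type*} [Ring R] (c : R) :
    tr ((p : R) ^ k * c) = p ^ k • tr c := by
  rw [← map_nsmul, nsmul_eq_mul, Nat.cast_pow]

theorem ghost_cons_zero (p : ℕ) {R : Type*} [Ring R] {n : ℕ} (c : R) (a : Fin n → R) :
    ghost p (Fin.cons c a : Fin (n + 1) → R) 0 = tr c := by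
  simp only [ghost, wittPoly]
  change tr (∑ j : Fin (0 + 1), _) = _
  rw [Fin.sum_univ_succ, Finset.univ_eq_empty, Finset.sum_empty, add_zero]
  congr 1
  have e : (Fin.castLE (0 : Fin (n + 1)).2 (0 : Fin (0 + 1)) : Fin (n + 1)) = 0 := rfl
  rw [e, Fin.cons_zero]
  simp

theorem ghost_cons_succ (p : ℕ) {R : Type*} [Ring R] {n : ℕ} (c : R) (a : Fin n → R)
    (i : Fin n) : ghost p (Fin.cons c a : Fin (n + 1) → R) i.succ =
      tr (c ^ p ^ (i.1 + 1)) + p • ghost p a i := by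
  simp only [ghost, wittPoly]
  change tr (∑ j : Fin (i.1 + 1 + 1), _) = _
  rw [Fin.sum_univ_succ, map_add, ← map_nsmul, Finset.smul_sum]
  congr 2
  · simp
  · refine Finset.sum_congr rfl fun j _ => ?_
    have e : (Fin.castLE i.succ.2 j.succ : Fin (n + 1)) = (Fin.castLE i.2 j).succ := rfl
    rw [e, Fin.cons_succ, nsmul_eq_mul, ← mul_assoc]
    congr 2
    · simp [pow_succ']
    · simp

/-- The sequence of ghost components of `V ^ k ⟨c⟩`. -/
def ghostGen (p : ℕ) {R : Type*} [Ring R] (k : ℕ) (c : R) : ℕ → R ⧸ commSub R :=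
  fun i => if k ≤ i then p ^ k • tr (c ^ p ^ (i - k)) else 0

/-- The group generated by the sequences of ghost components of the `V ^ k ⟨c⟩`. -/
def ghostGens (p : ℕ) (R : Type*) [Ring R] : AddSubgroup (ℕ → R ⧸ commSub R) :=
  AddSubgroup.closure {g | ∃ k c, g = ghostGen p k c}

theorem tr_add_pow (p : ℕ) [Fact p.Prime] {R : Type*} [Ring R] (c d : R) (n : ℕ) :
    ∃ h ∈ ghostGens p R, tr (c + d) = tr c + tr d ∧ ∀ i < n,
      tr ((c + d) ^ p ^ (i + 1)) = tr (c ^ p ^ (i + 1)) + tr (d ^ p ^ (i + 1)) + p • h i := by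
  obtain ⟨U, hU⟩ := necklace_expansion p c d
  refine ⟨∑ k ∈ Finset.range n, ((U k).map fun u => ghostGen p k u).sum,
    sum_mem fun k _ => AddSubgroup.multiset_sum_mem _ _ fun g hg => ?_, map_add _ _ _,
    fun i hi => ?_⟩
  · obtain ⟨u, -, rfl⟩ := Multiset.mem_map.1 hg
    exact AddSubgroup.subset_closure ⟨k, u, rfl⟩
  · rw [hU]
    congr 1
    have hev : ∀ s : Multiset (ℕ → R ⧸ commSub R), s.sum i = (s.map fun g => g i).sum :=
      fun s => map_multiset_sum (Pi.evalAddMonoidHom _ i) s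
    rw [Finset.sum_apply, Finset.smul_sum, ← Finset.sum_subset
      (Finset.range_subset_range.2 (Nat.succ_le_of_lt hi))]
    · refine Finset.sum_congr rfl fun k hk => ?_
      have hk' : k ≤ i := by simpa [Nat.lt_succ_iff] using hk
      rw [hev, Multiset.map_map, ← Multiset.sum_map_nsmul, ← Multiset.sum_map_nsmul]
      congr 1
      refine Multiset.map_congr rfl fun u _ => ?_
      simp only [Function.comp, ghostGen, if_pos hk', Nat.add_sub_add_right]
      rw [← mul_nsmul, pow_succ]
    · intro k _ hk
      have hk' : ¬ k ≤ i := by simpa [Nat.lt_succ_iff] using hk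
      rw [hev, Multiset.map_map]
      rw [Multiset.map_congr rfl (g := fun _ => (0 : R ⧸ commSub R)) fun u _ => by simp only [Function.comp, ghostGen, if_neg hk']]
      simp

theorem ghostGens_split (p : ℕ) [hp : Fact p.Prime] {R : Type*} [Ring R] (n : ℕ)
    (g : ℕ → R ⧸ commSub R) (hg : g ∈ ghostGens p R) : ∃ c : R, ∃ h ∈ ghostGens p R,
      g 0 = tr c ∧ ∀ i < n, g (i + 1) = tr (c ^ p ^ (i + 1)) + p • h i := by
  have hp0 : ∀ i, p ^ i ≠ 0 := fun i => pow_ne_zero _ hp.out.ne_zero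
  induction hg using AddSubgroup.closure_induction with
  | mem g hg =>
    obtain ⟨k, c, rfl⟩ := hg
    rcases k with _ | k
    · exact ⟨c, 0, zero_mem _, by simp [ghostGen], fun i _ => by simp [ghostGen]⟩
    · refine ⟨0, ghostGen p k c, AddSubgroup.subset_closure ⟨k, c, rfl⟩, by simp [ghostGen],
        fun i _ => ?_⟩
      rw [zero_pow (hp0 _), map_zero, zero_add]
      by_cases hk : k ≤ i
      · simp only [ghostGen, Nat.add_sub_add_right, if_pos hk, if_pos (Nat.add_le_add_right hk 1)]
        rw [← mul_nsmul, pow_succ]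
      · simp [ghostGen, hk]
  | zero =>
    exact ⟨0, 0, zero_mem _, by simp, fun i _ => by simp [zero_pow (hp0 _)]⟩
  | add g g' _ _ h1 h2 =>
    obtain ⟨c, h, hh, e0, e⟩ := h1
    obtain ⟨c', h', hh', e0', e'⟩ := h2
    obtain ⟨f, hf, f0, fe⟩ := tr_add_pow p c c' n
    refine ⟨c + c', h + h' - f, sub_mem (add_mem hh hh') hf, by simp [e0, e0'], fun i hi => ?_⟩
    rw [Pi.add_apply, e i hi, e' i hi, fe i hi, Pi.sub_apply, Pi.add_apply, nsmul_sub, nsmul_add]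
    abel
  | neg g _ h1 =>
    obtain ⟨c, h, hh, e0, e⟩ := h1
    obtain ⟨f, hf, f0, fe⟩ := tr_add_pow p c (-c) n
    refine ⟨-c, f - h, sub_mem hf hh, by simp [e0], fun i hi => ?_⟩
    have := fe i hi
    rw [add_neg_cancel, zero_pow (hp0 _), map_zero] at this
    rw [Pi.neg_apply, e i hi, Pi.sub_apply, nsmul_sub,
      eq_comm, ← sub_eq_zero, this]
    abel

theorem exists_ghost_eq (p : ℕ) [Fact p.Prime] {R : Type*} [Ring R] (n : ℕ)
    (g : ℕ → R ⧸ commSub R) (hg : g ∈ ghostGens p R) :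
    ∃ a : Fin n → R, ghost p a = fun i : Fin n => g i := by
  induction n generalizing g with
  | zero => exact ⟨Fin.elim0, funext fun i => i.elim0⟩
  | succ n ih =>
    obtain ⟨c, h, hh, e0, e⟩ := ghostGens_split p n g hg
    obtain ⟨a, ha⟩ := ih h hh
    refine ⟨Fin.cons c a, funext fun i => ?_⟩
    refine Fin.cases ?_ (fun i => ?_) i
    · rw [ghost_cons_zero, e0.symm]; rfl
    · rw [ghost_cons_succ, ha, Fin.val_succ, e i i.2]

theorem exists_ghostGens_eq (p : ℕ) {R : Type*} [Ring R] {n : ℕ} (a : Fin n → R) :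
    ∃ g ∈ ghostGens p R, ghost p a = fun i : Fin n => g i := by
  refine ⟨∑ j : Fin n, ghostGen p j (a j),
    sum_mem fun j _ => AddSubgroup.subset_closure ⟨j, a j, rfl⟩, funext fun i => ?_⟩
  rw [Finset.sum_apply, ghost, wittPoly, map_sum]
  have hinj : Function.Injective (Fin.castLE i.2 : Fin (i.1 + 1) → Fin n) :=
    Fin.castLE_injective _
  rw [← Finset.sum_subset (Finset.subset_univ (Finset.univ.map ⟨_, hinj⟩)), Finset.sum_map]
  · refine Finset.sum_congr rfl fun j _ => ?_
    have hj : j.1 ≤ i.1 := Nat.lt_succ_iff.1 j.2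
    simp only [Function.Embedding.coeFn_mk, ghostGen, Fin.val_castLE, if_pos hj]
    exact tr_mul_natCast_pow p _ _
  · intro j _ hj
    have hj' : ¬ j.1 ≤ i.1 := fun h =>
      hj (Finset.mem_map.2 ⟨⟨j.1, Nat.lt_succ_of_le h⟩, Finset.mem_univ _, rfl⟩)
    simp [ghostGen, hj']

/-- The image of the ghost map, a subgroup of `(R / [R, R])ⁿ`. -/
def ghostImage (p : ℕ) [Fact p.Prime] (R : Type*) [Ring R] (n : ℕ) :
    AddSubgroup (Fin n → R ⧸ commSub R) where
  carrier := Set.range (ghost p)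
  zero_mem' := by
    obtain ⟨a, ha⟩ := exists_ghost_eq p n (0 : ℕ → R ⧸ commSub R) (zero_mem _)
    exact ⟨a, ha⟩
  add_mem' := by
    rintro _ _ ⟨a, rfl⟩ ⟨b, rfl⟩
    obtain ⟨g, hg, e⟩ := exists_ghostGens_eq p a
    obtain ⟨h, hh, f⟩ := exists_ghostGens_eq p b
    obtain ⟨c, hc⟩ := exists_ghost_eq p n (g + h) (add_mem hg hh)
    exact ⟨c, by rw [hc, e, f]; rfl⟩
  neg_mem' := by
    rintro _ ⟨a, rfl⟩
    obtain ⟨g, hg, e⟩ := exists_ghostGens_eq p a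
    obtain ⟨c, hc⟩ := exists_ghost_eq p n (-g) (neg_mem hg)
    exact ⟨c, by rw [hc, e]; rfl⟩


/-! ### Hesselholt's group `W(A)` -/

/-- `(x₀, …, xₙ₋₁) ↦ (0, x₀, …, xₙ₋₂)`. -/
def shiftRight {M : Type*} [Zero M] {n : ℕ} (x : Fin n → M) : Fin n → M :=
  fun i => if i.1 = 0 then 0 else x ⟨i.1 - 1, (Nat.sub_le _ _).trans_lt i.2⟩

theorem ghost_shiftRight (p : ℕ) [hp : Fact p.Prime] {R : Type*} [Ring R] {n : ℕ}
    (a : Fin n → R) : ghost p (shiftRight a) = p • shiftRight (ghost p a) := by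
  rcases n with _ | n
  · exact funext fun i => i.elim0
  have e : shiftRight a = Fin.cons 0 fun i : Fin n => a i.castSucc := by
    funext i
    refine Fin.cases ?_ (fun i => ?_) i
    · simp [shiftRight]
    · simp only [shiftRight, Fin.val_succ, Nat.add_one_ne_zero, if_false, Fin.cons_succ]
      rfl
  funext i
  refine Fin.cases ?_ (fun i => ?_) i
  · rw [e, ghost_cons_zero, map_zero]
    simp [shiftRight]
  · rw [e, ghost_cons_succ, zero_pow (pow_ne_zero _ hp.out.ne_zero), map_zero, zero_add,
      Pi.smul_apply]
    simp only [shiftRight, Fin.val_succ, Nat.add_one_ne_zero, if_false]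
    rfl

/-- The canonical surjection from the free ring on the set `A` to the ring `A`. -/
def freeEval (A : Type*) [Ring A] : FreeAlgebra ℤ A →ₐ[ℤ] A := FreeAlgebra.lift ℤ id

/-- The subgroup generated by the differences of ghost vectors `ω(x) - ω(y)`, where `x` and `y` are
vectors over the free ring on `A` with the same image in `Aⁿ`. -/
def ghostRel (p : ℕ) [Fact p.Prime] (A : Type*) [Ring A] (n : ℕ) :
    AddSubgroup (ghostImage p (FreeAlgebra ℤ A) n) :=
  AddSubgroup.closure {z | ∃ x y : Fin n → FreeAlgebra ℤ A,
    (∀ i, freeEval A (x i) = freeEval A (y i)) ∧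
      (z : Fin n → FreeAlgebra ℤ A ⧸ commSub (FreeAlgebra ℤ A)) = ghost p x - ghost p y}

/-- Hesselholt's group `Wₙ(A)` of Witt vectors of length `n`. Let `P` be the free ring on the set
`A`. As `P / [P, P]` has no `p`-torsion, `Wₙ(P)` is the image of the ghost map
`Pⁿ → (P / [P, P])ⁿ`, and `Wₙ(A)` is its quotient which identifies two Witt vectors over `P` whose
coordinates have the same images in `A`. -/
def WLen (p : ℕ) [Fact p.Prime] (A : Type*) [Ring A] (n : ℕ) : Type _ :=
  ghostImage p (FreeAlgebra ℤ A) n ⧸ ghostRel p A n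

instance (p : ℕ) [Fact p.Prime] (A : Type*) [Ring A] (n : ℕ) : AddCommGroup (WLen p A n) :=
  inferInstanceAs (AddCommGroup (ghostImage p (FreeAlgebra ℤ A) n ⧸ ghostRel p A n))

/-- `Wₙ(A)` is discrete. -/
instance (p : ℕ) [Fact p.Prime] (A : Type*) [Ring A] (n : ℕ) : TopologicalSpace (WLen p A n) := ⊥

instance (p : ℕ) [Fact p.Prime] (A : Type*) [Ring A] (n : ℕ) : DiscreteTopology (WLen p A n) :=
  ⟨rfl⟩

namespace WLen

variable {p : ℕ} [Fact p.Prime] {A : Type*} [Ring A] {n : ℕ}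

/-- The class in `Wₙ(A)` of the ghost vector of a vector over the free ring. -/
def ofFree (x : Fin n → FreeAlgebra ℤ A) : WLen p A n :=
  QuotientAddGroup.mk' (ghostRel p A n) ⟨ghost p x, x, rfl⟩

/-- The map `qₙ : Aⁿ → Wₙ(A)`. -/
def q (a : Fin n → A) : WLen p A n := ofFree fun i => FreeAlgebra.ι ℤ (a i)

theorem ofFree_eq {x y : Fin n → FreeAlgebra ℤ A}
    (h : ∀ i, freeEval A (x i) = freeEval A (y i)) : (ofFree x : WLen p A n) = ofFree y := by
  refine QuotientAddGroup.eq.2 (AddSubgroup.subset_closure ⟨y, x, fun i => (h i).symm, ?_⟩)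
  exact neg_add_eq_sub _ _

theorem ofFree_eq_q (x : Fin n → FreeAlgebra ℤ A) :
    (ofFree x : WLen p A n) = q fun i => freeEval A (x i) :=
  ofFree_eq fun i => by simp [freeEval]

theorem q_surjective : Function.Surjective (q : (Fin n → A) → WLen p A n) := by
  intro w
  obtain ⟨⟨z, x, rfl⟩, rfl⟩ := QuotientAddGroup.mk'_surjective (ghostRel p A n) w
  exact ⟨_, (ofFree_eq_q x).symm⟩

/-- Truncation of ghost vectors. -/
def resGhost (p : ℕ) [Fact p.Prime] (R : Type*) [Ring R] (n : ℕ) :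
    ghostImage p R (n + 1) →+ ghostImage p R n where
  toFun z := ⟨fun i => z.1 i.castSucc, by
    obtain ⟨z, x, rfl⟩ := z
    exact ⟨fun i => x i.castSucc, rfl⟩⟩
  map_zero' := rfl
  map_add' _ _ := rfl

/-- The restriction map `Wₙ₊₁(A) → Wₙ(A)`, `(a₀, …, aₙ) ↦ (a₀, …, aₙ₋₁)`. -/
def res (p : ℕ) [Fact p.Prime] (A : Type*) [Ring A] (n : ℕ) : WLen p A (n + 1) →+ WLen p A n :=
  QuotientAddGroup.map _ _ (resGhost p (FreeAlgebra ℤ A) n) (by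
    rw [ghostRel, AddSubgroup.closure_le]
    rintro z ⟨x, y, h, e⟩
    refine AddSubgroup.subset_closure
      ⟨fun i => x i.castSucc, fun i => y i.castSucc, fun i => h _, ?_⟩
    change (fun i : Fin n => z.1 i.castSucc) = _
    rw [e]
    rfl)

theorem res_q (a : Fin (n + 1) → A) : res p A n (q a) = q fun i => a i.castSucc := rfl

/-- The Verschiebung on ghost vectors. -/
def verGhost (p : ℕ) [Fact p.Prime] (R : Type*) [Ring R] (n : ℕ) :
    ghostImage p R n →+ ghostImage p R n where
  toFun z := ⟨p • shiftRight z.1, by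
    obtain ⟨z, x, rfl⟩ := z
    exact ⟨shiftRight x, ghost_shiftRight p x⟩⟩
  map_zero' := by ext i; simp [shiftRight]
  map_add' z w := by
    ext i
    by_cases h : i.1 = 0 <;> simp [shiftRight, h, nsmul_add]

/-- The Verschiebung `Wₙ(A) → Wₙ(A)`. -/
def V (p : ℕ) [Fact p.Prime] (A : Type*) [Ring A] (n : ℕ) : WLen p A n →+ WLen p A n :=
  QuotientAddGroup.map _ _ (verGhost p (FreeAlgebra ℤ A) n) (by
    rw [ghostRel, AddSubgroup.closure_le]
    rintro z ⟨x, y, h, e⟩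
    refine AddSubgroup.subset_closure ⟨shiftRight x, shiftRight y, fun i => ?_, ?_⟩
    · by_cases hi : i.1 = 0 <;> simp [shiftRight, hi, h]
    · change p • shiftRight z.1 = _
      rw [e, ghost_shiftRight, ghost_shiftRight, ← nsmul_sub]
      congr 1
      funext i
      by_cases hi : i.1 = 0 <;> simp [shiftRight, hi])

theorem V_q (a : Fin n → A) : V p A n (q a) = q (shiftRight a) := by
  have h : V p A n (q a) = ofFree (shiftRight fun i => FreeAlgebra.ι ℤ (a i)) := by
    refine congrArg (QuotientAddGroup.mk' (ghostRel p A n)) (Subtype.ext ?_)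
    exact (ghost_shiftRight p _).symm
  rw [h, ofFree_eq_q]
  congr 1
  funext i
  by_cases hi : i.1 = 0 <;> simp [shiftRight, hi, freeEval]

theorem res_V (w : WLen p A (n + 1)) : res p A n (V p A (n + 1) w) = V p A n (res p A n w) := by
  obtain ⟨a, rfl⟩ := q_surjective w
  rw [V_q, res_q, res_q, V_q]
  rfl

end WLen

/-- Hesselholt's group of Witt vectors `W(A) = lim Wₙ(A)`, with the topology of the inverse limit
of discrete groups. -/
abbrev HWitt (p : ℕ) [Fact p.Prime] (A : Type*) [Ring A] : Type _ :=
  ({ carrier := {w | ∀ n, WLen.res p A n (w (n + 1)) = w n}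
     zero_mem' := fun n => map_zero _
     add_mem' := fun {v w} hv hw n => by
      rw [Pi.add_apply, Pi.add_apply, map_add, hv n, hw n]
     neg_mem' := fun {w} hw n => by
      rw [Pi.neg_apply, Pi.neg_apply, map_neg, hw n] } : AddSubgroup (∀ n, WLen p A n))

namespace HWitt

/-- The map `q` from sequences in `A` to `W(A)`. -/
def q (p : ℕ) [Fact p.Prime] {A : Type*} [Ring A] (a : ℕ → A) : HWitt p A :=
  ⟨fun n => WLen.q fun i : Fin n => a i, fun _ => WLen.res_q _⟩

/-- The Teichmüller map `⟨a⟩ = (a, 0, 0, …)`. -/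
def teich (p : ℕ) [Fact p.Prime] {A : Type*} [Ring A] (a : A) : HWitt p A :=
  q p fun i => if i = 0 then a else 0

/-- The Verschiebung `V (a₀, a₁, …) = (0, a₀, a₁, …)`. -/
def V (p : ℕ) [Fact p.Prime] (A : Type*) [Ring A] : HWitt p A →+ HWitt p A where
  toFun w := ⟨fun n => WLen.V p A n (w.1 n), fun n => by rw [WLen.res_V, w.2 n]⟩
  map_zero' := Subtype.ext (funext fun n => map_zero _)
  map_add' v w := Subtype.ext (funext fun n => map_add (WLen.V p A n) (v.1 n) (w.1 n))

end HWitt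

/-! ### The ring `E(A)` of Cuntz and Deninger -/

/-- The ring `R^ℕ` of sequences in a ring `R`, with the product of the discrete topologies. -/
def Seq (R : Type*) : Type _ := ℕ → R

namespace Seq

instance (R : Type*) [Ring R] : Ring (Seq R) := inferInstanceAs (Ring (ℕ → R))

instance (R : Type*) : TopologicalSpace (Seq R) :=
  @Pi.topologicalSpace ℕ (fun _ => R) fun _ => ⊥

instance (R : Type*) [Ring R] : IsTopologicalRing (Seq R) := by
  let _ : TopologicalSpace R := ⊥
  have : DiscreteTopology R := ⟨rfl⟩
  exact inferInstanceAs (IsTopologicalRing (ℕ → R))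

/-- `V (a₀, a₁, …) = p (0, a₀, a₁, …)`. -/
def V (p : ℕ) {R : Type*} [Ring R] : Seq R →+ Seq R where
  toFun x := fun i => Nat.casesOn i 0 fun j => (p : R) * x j
  map_zero' := by 
    funext i
    cases i with
    | zero => rfl
    | succ j => exact mul_zero _
  map_add' x y := by
    funext i
    cases i with
    | zero => exact (add_zero (0 : R)).symm
    | succ j => exact mul_add _ _ _

/-- `⟨a⟩ = (a, a ^ p, a ^ (p ^ 2), …)`. -/
def teich (p : ℕ) {R : Type*} [Ring R] (a : R) : Seq R := fun i => a ^ p ^ i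

/-- The closed subgroup of `R^ℕ` generated by the elements `V ^ m (⟨a₁⟩ ⋯ ⟨aᵣ⟩)` with `r ≥ 1` and
all `aᵢ` in `T`. -/
def XSub (p : ℕ) {R : Type*} [Ring R] (T : Set R) : AddSubgroup (Seq R) :=
  (AddSubgroup.closure {z | ∃ (m : ℕ) (l : List R), l ≠ [] ∧ (∀ a ∈ l, a ∈ T) ∧
    z = (V p)^[m] (l.map (teich p)).prod}).topologicalClosure

theorem continuous_iff {X R : Type*} [TopologicalSpace X] {f : X → Seq R} :
    Continuous f ↔ ∀ i, @Continuous X R _ ⊥ fun x => f x i :=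
  @continuous_pi_iff X ℕ (fun _ => R) _ (fun _ => ⊥) f

theorem continuous_V (p : ℕ) {R : Type*} [Ring R] : Continuous (V p : Seq R → Seq R) := by
  refine continuous_iff.2 fun i => ?_
  let _ : TopologicalSpace R := ⊥
  have : DiscreteTopology R := ⟨rfl⟩
  cases i with
  | zero => exact continuous_const
  | succ j =>
    have h : Continuous fun x : Seq R => x j := continuous_apply (A := fun _ : ℕ => R) j
    exact (continuous_of_discreteTopology (f := fun r : R => (p : R) * r)).comp h

theorem V_mem_XSub (p : ℕ) {R : Type*} [Ring R] {T : Set R} {x : Seq R} (hx : x ∈ XSub p T) :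
    V p x ∈ XSub p T := by
  refine map_mem_closure (continuous_V p) hx fun y hy => ?_
  change y ∈ AddSubgroup.closure _ at hy
  change V p y ∈ AddSubgroup.closure _
  refine (AddSubgroup.closure_le ((AddSubgroup.closure _).comap (V p))).2 ?_ hy
  rintro _ ⟨m, l, h1, h2, rfl⟩
  refine AddSubgroup.subset_closure ⟨m + 1, l, h1, h2, ?_⟩
  rw [Function.iterate_succ_apply']

theorem V_iterate_apply (p : ℕ) {R : Type*} [Ring R] (m : ℕ) (x : Seq R) (i : ℕ) :
    (V p)^[m] x i = if m ≤ i then (p : R) ^ m * x (i - m) else 0 := by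
  induction m generalizing i with
  | zero => simp
  | succ m ih =>
    rw [Function.iterate_succ_apply']
    cases i with
    | zero => rfl
    | succ j =>
      change (p : R) * (V p)^[m] x j = _
      rw [ih]
      by_cases h : m ≤ j
      · rw [if_pos h, if_pos (Nat.add_le_add_right h 1), ← mul_assoc, ← pow_succ',
          Nat.add_sub_add_right]
      · rw [if_neg h, if_neg (by omega), mul_zero]

theorem prod_teich_apply (p : ℕ) {R : Type*} [Ring R] (l : List R) (i : ℕ) :
    (l.map (teich p)).prod i = (l.map fun a => a ^ p ^ i).prod := by
  induction l with
  | nil => rfl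
  | cons a l ih =>
    rw [List.map_cons, List.prod_cons, List.map_cons, List.prod_cons, ← ih]
    rfl

theorem prod_teich_pow_apply (p : ℕ) {R : Type*} [Ring R] (l : List R) (k i : ℕ) :
    ((l.map fun a => a ^ p ^ k).map (teich p)).prod i = (l.map (teich p)).prod (i + k) := by
  rw [prod_teich_apply, prod_teich_apply, List.map_map]
  congr 2
  funext a
  simp only [Function.comp]
  rw [← pow_mul, ← pow_add, add_comm]

theorem gen_mul_gen (p : ℕ) {R : Type*} [Ring R] {m n : ℕ} (h : m ≤ n) (k l : List R) :
    (V p)^[n] (k.map (teich p)).prod * (V p)^[m] (l.map (teich p)).prod =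
        p ^ m • (V p)^[n] ((k ++ l.map fun a => a ^ p ^ (n - m)).map (teich p)).prod ∧
      (V p)^[m] (l.map (teich p)).prod * (V p)^[n] (k.map (teich p)).prod =
        p ^ m • (V p)^[n] (((l.map fun a => a ^ p ^ (n - m)) ++ k).map (teich p)).prod := by
  have hc : ∀ (e : ℕ) (x : R), (p : R) ^ e * x = x * (p : R) ^ e := fun e x =>
    ((Nat.cast_commute p x).pow_left e).eq
  constructor
  · funext i
    change (V p)^[n] _ i * (V p)^[m] _ i = p ^ m • ((V p)^[n] _ i : R)
    rw [V_iterate_apply, V_iterate_apply, V_iterate_apply]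
    by_cases hi : n ≤ i
    · rw [if_pos hi, if_pos (h.trans hi), if_pos hi, List.map_append, List.prod_append]
      change _ = p ^ m • ((p : R) ^ n * ((k.map (teich p)).prod (i - n) *
        ((l.map fun a => a ^ p ^ (n - m)).map (teich p)).prod (i - n)))
      rw [prod_teich_pow_apply, show i - n + (n - m) = i - m by omega, nsmul_eq_mul, Nat.cast_pow]
      generalize (k.map (teich p)).prod (i - n) = x
      generalize (l.map (teich p)).prod (i - m) = y
      rw [mul_assoc, ← mul_assoc x, ← hc m x, mul_assoc, ← mul_assoc ((p : R) ^ n),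
        ← mul_assoc ((p : R) ^ m), hc m ((p : R) ^ n)]
    · rw [if_neg hi, if_neg hi, zero_mul, smul_zero]
  · funext i
    change (V p)^[m] _ i * (V p)^[n] _ i = p ^ m • ((V p)^[n] _ i : R)
    rw [V_iterate_apply, V_iterate_apply, V_iterate_apply]
    by_cases hi : n ≤ i
    · rw [if_pos hi, if_pos (h.trans hi), if_pos hi, List.map_append, List.prod_append]
      change _ = p ^ m • ((p : R) ^ n * (((l.map fun a => a ^ p ^ (n - m)).map (teich p)).prod
        (i - n) * (k.map (teich p)).prod (i - n)))
      rw [prod_teich_pow_apply, show i - n + (n - m) = i - m by omega, nsmul_eq_mul, Nat.cast_pow]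
      generalize (k.map (teich p)).prod (i - n) = x
      generalize (l.map (teich p)).prod (i - m) = y
      rw [mul_assoc, ← mul_assoc y, ← hc n y, mul_assoc]
    · rw [if_neg hi, if_neg hi, mul_zero, smul_zero]

/-- The ring `X(R)`. -/
def X (p : ℕ) (R : Type*) [Ring R] : Subring (Seq R) where
  __ := XSub p (Set.univ : Set R)
  mul_mem' := by
    intro x y hx hy
    refine map_mem_closure₂ continuous_mul hx hy fun x hx y hy => ?_
    change x ∈ AddSubgroup.closure _ at hx
    change y ∈ AddSubgroup.closure _ at hy
    change x * y ∈ AddSubgroup.closure _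
    induction hx, hy using AddSubgroup.closure_induction₂ with
    | mem x y hx hy =>
      obtain ⟨n, k, hk, -, rfl⟩ := hx
      obtain ⟨m, l, hl, -, rfl⟩ := hy
      rcases le_total m n with h | h
      · rw [(gen_mul_gen p h k l).1]
        refine AddSubgroup.nsmul_mem _ (AddSubgroup.subset_closure ?_) _
        exact ⟨n, k ++ l.map fun a => a ^ p ^ (n - m), by simp [hk], by simp, rfl⟩
      · rw [(gen_mul_gen p h l k).2]
        refine AddSubgroup.nsmul_mem _ (AddSubgroup.subset_closure ?_) _
        exact ⟨m, (k.map fun a => a ^ p ^ (m - n)) ++ l, by simp [hl], by simp, rfl⟩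
    | zero_left y _ => rw [zero_mul]; exact zero_mem _
    | zero_right x _ => rw [mul_zero]; exact zero_mem _
    | add_left x y z _ _ _ h1 h2 => rw [add_mul]; exact add_mem h1 h2
    | add_right x y z _ _ _ h1 h2 => rw [mul_add]; exact add_mem h1 h2
    | neg_left x y _ _ h => rw [neg_mul]; exact neg_mem h
    | neg_right x y _ _ h => rw [mul_neg]; exact neg_mem h
  one_mem' := by
    refine AddSubgroup.le_topologicalClosure _ (AddSubgroup.subset_closure
      ⟨0, [1], by simp, by simp, ?_⟩)
    funext i
    change (1 : R) = ([(1 : R)].map (teich p)).prod i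
    rw [prod_teich_apply]
    simp

theorem teich_mem_X (p : ℕ) {R : Type*} [Ring R] (a : R) : teich p a ∈ X p R :=
  AddSubgroup.le_topologicalClosure _ (AddSubgroup.subset_closure
    ⟨0, [a], by simp, by simp, by simp⟩)

/-- The Verschiebung on `X(R)`. -/
def VX (p : ℕ) (R : Type*) [Ring R] : X p R →+ X p R where
  toFun x := ⟨V p x.1, V_mem_XSub p x.2⟩
  map_zero' := Subtype.ext (map_zero _)
  map_add' _ _ := Subtype.ext (map_add _ _ _)

end Seq

/-- The canonical surjection `ℤA → A`, `[a] ↦ a`, from the monoid algebra of the multiplicative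
monoid of `A`. -/
noncomputable def monEval (A : Type*) [Ring A] : MonoidAlgebra ℤ A →ₐ[ℤ] A :=
  MonoidAlgebra.lift ℤ A A (MonoidHom.id A)

/-- `X(I)`, `I` the kernel of `ℤA → A`, as a subgroup of `X(ℤA)`. -/
noncomputable def XKer (p : ℕ) (A : Type*) [Ring A] : AddSubgroup (Seq.X p (MonoidAlgebra ℤ A)) :=
  (Seq.XSub p {r | monEval A r = 0}).comap (Seq.X p (MonoidAlgebra ℤ A)).subtype.toAddMonoidHom

/-- `E(A) = X(ℤA) / X(I)`, with the quotient topology. -/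
abbrev CDWitt (p : ℕ) (A : Type*) [Ring A] : Type _ :=
  Seq.X p (MonoidAlgebra ℤ A) ⧸ XKer p A

namespace CDWitt

/-- The quotient map `X(ℤA) → E(A)`. -/
noncomputable def proj (p : ℕ) (A : Type*) [Ring A] : Seq.X p (MonoidAlgebra ℤ A) →+ CDWitt p A :=
  QuotientAddGroup.mk' (XKer p A)

/-- The Verschiebung on `E(A)`. -/
noncomputable def V (p : ℕ) (A : Type*) [Ring A] : CDWitt p A →+ CDWitt p A :=
  QuotientAddGroup.map _ _ (Seq.VX p (MonoidAlgebra ℤ A)) fun _ hx => Seq.V_mem_XSub p hx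

/-- The element `([a], [a] ^ p, [a] ^ (p ^ 2), …)` of `X(ℤA)`. -/
noncomputable def teichX (p : ℕ) {A : Type*} [Ring A] (a : A) : Seq.X p (MonoidAlgebra ℤ A) :=
  ⟨Seq.teich p (MonoidAlgebra.of ℤ A a), Seq.teich_mem_X p _⟩

/-- The Teichmüller map `A → E(A)`. -/
noncomputable def teich (p : ℕ) {A : Type*} [Ring A] (a : A) : CDWitt p A := proj p A (teichX p a)

/-- The closure of `[E(A), E(A)]`. The multiplication of `E(A)` is induced by that of `X(ℤA)`, so
that the commutators in `E(A)` are the classes of the commutators in `X(ℤA)`. -/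
noncomputable def comm (p : ℕ) (A : Type*) [Ring A] : AddSubgroup (CDWitt p A) :=
  (AddSubgroup.closure {z | ∃ x y : Seq.X p (MonoidAlgebra ℤ A),
    z = proj p A (x * y - y * x)}).topologicalClosure

end CDWitt

/-- `HH₀(E(A))`, the quotient of `E(A)` by the closure of `[E(A), E(A)]`, with the quotient
topology. -/
abbrev HH0 (p : ℕ) (A : Type*) [Ring A] : Type _ := CDWitt p A ⧸ CDWitt.comm p A

/-- The quotient map `E(A) → HH₀(E(A))`. -/
noncomputable def HH0.proj (p : ℕ) (A : Type*) [Ring A] : CDWitt p A →+ HH0 p A :=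
  QuotientAddGroup.mk' (CDWitt.comm p A)

/-- The elements `V ^ n ⟨a⟩` of `W(A)`. -/
def HWitt.gens (p : ℕ) [Fact p.Prime] (A : Type*) [Ring A] : Set (HWitt p A) :=
  {w | ∃ (n : ℕ) (a : A), w = (HWitt.V p A)^[n] (HWitt.teich p a)}

/-- The classes in `HH₀(E(A))` of the elements `V ^ n ⟨a⟩` of `E(A)`. -/
def HH0.gens (p : ℕ) (A : Type*) [Ring A] : Set (HH0 p A) :=
  {h | ∃ (n : ℕ) (a : A), h = HH0.proj p A ((CDWitt.V p A)^[n] (CDWitt.teich p a))}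

/-- The map `f : W(A) → HH₀(E(A))` commutes with the Verschiebung: for every `w` in `W(A)`, the
element `f (V w)` is the class of `V e` for a representative `e` in `E(A)` of `f w`. When the
Verschiebung of `E(A)` descends to `HH₀(E(A))`, this says that `f ∘ V = V ∘ f`; the condition makes
sense without assuming this. -/
def CommutesWithV (p : ℕ) [Fact p.Prime] (A : Type*) [Ring A] (f : HWitt p A → HH0 p A) : Prop :=
  ∀ w : HWitt p A, ∃ e : CDWitt p A,
    HH0.proj p A e = f w ∧ HH0.proj p A (CDWitt.V p A e) = f (HWitt.V p A w)

/-- The ring `ℤ{X, Y}` of polynomials in two non-commuting variables. -/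
abbrev ZXY : Type := FreeAlgebra ℤ (Fin 2)

end NCWitt

namespace NCWitt

/-! (i) The ghost vector of $(a_0,\dots,a_{n-1})$ is the sum of the ghost vectors of its coordinates
placed in their slots, so in $W_n(A)$ every element is $\sum_j V^j\langle a_j\rangle$. In the
inverse limit of discrete groups this gives density.

(ii) and (iii) each use a continuous homomorphism $G$ from $HH_0(E(A))$ to the discrete group
$\mathbb F_2$, built from the images in $A$ of the components $x_0, x_1$ of $x\in X(\mathbb ZA)$
(`ghostPairing_exists_lift`). The algebra $A$ is represented by $X\mapsto E_{01}$, $Y\mapsto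
sE_{10}$ (`matRep`).

For (ii), take $s=1$ over $\mathbb F_2$ and $G(x)=\mathrm{tr}(x_0)+\mathrm{tr}(x_1)$. Since
$\mathrm{tr}(P^2)=\mathrm{tr}(P)$ over $\mathbb F_2$, this kills every $V^n\langle a\rangle$. On
$\langle X\rangle\langle Y\rangle$ it is $\mathrm{tr}(XY)+\mathrm{tr}(X^2Y^2)=1+0$.

For (iii), $\langle XY\rangle=\langle YX\rangle$ in $W(A)$ (`HWitt.teich_mul_comm`), because there
the powers of $XY$ and $YX$ agree modulo all commutators. In $HH_0(E(A))$ the two classes differ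
(`HH0.proj_teich_mul_ne`). The reason is that, modulo 2, $x_1$ is a sum of products of squares, so
$XYXY-YXYX=[X,YXY]$ need not come from a commutator of $X(\mathbb ZA)$. Over $\mathbb F_2[s]$ such
products of squares lie in a subring whose commutators have $(0,0)$ entry divisible by $s^3$,
whereas $(XY)^2\mapsto s^2E_{00}$ and $(YX)^2\mapsto s^2E_{11}$. -/

/-! ### Hesselholt's group: generators, and symmetry of the Teichmüller map. -/

theorem ghost_eq_sum_ghostGen (p : ℕ) {R : Type*} [Ring R] {n : ℕ} (a : Fin n → R) (i : Fin n) :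
    ghost p a i = ∑ j : Fin n, ghostGen p j (a j) i := by
  have hinj : Function.Injective (Fin.castLE i.2 : Fin (i.1 + 1) → Fin n) :=
    Fin.castLE_injective _
  rw [ghost, wittPoly, map_sum,
    ← Finset.sum_subset (Finset.subset_univ (Finset.univ.map ⟨_, hinj⟩)), Finset.sum_map]
  · refine Finset.sum_congr rfl fun j _ => ?_
    have hj : j.1 ≤ i.1 := Nat.lt_succ_iff.1 j.2
    simp only [Function.Embedding.coeFn_mk, ghostGen, Fin.val_castLE, if_pos hj]
    exact tr_mul_natCast_pow p _ _
  · intro j _ hj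
    have hj' : ¬ j.1 ≤ i.1 := fun h =>
      hj (Finset.mem_map.2 ⟨⟨j.1, Nat.lt_succ_of_le h⟩, Finset.mem_univ _, rfl⟩)
    simp [ghostGen, hj']

theorem ghostGen_zero (p : ℕ) [hp : Fact p.Prime] {R : Type*} [Ring R] (k i : ℕ) :
    ghostGen p k (0 : R) i = 0 := by
  simp [ghostGen, zero_pow (pow_ne_zero _ hp.out.ne_zero)]

theorem ghost_eq_sum_single (p : ℕ) [Fact p.Prime] {R : Type*} [Ring R] {n : ℕ} (a : Fin n → R) :
    ghost p a = ∑ j : Fin n, ghost p (Pi.single j (a j)) := by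
  funext i
  rw [Finset.sum_apply, ghost_eq_sum_ghostGen]
  refine Finset.sum_congr rfl fun j _ => ?_
  rw [ghost_eq_sum_ghostGen, Finset.sum_eq_single j, Pi.single_eq_same]
  · intro k _ hk
    rw [Pi.single_eq_of_ne hk, ghostGen_zero]
  · simp

theorem WLen.q_eq_sum_single {p : ℕ} [Fact p.Prime] {A : Type*} [Ring A] {n : ℕ}
    (a : Fin n → A) : (WLen.q a : WLen p A n) = ∑ j : Fin n, WLen.q (Pi.single j (a j)) := by
  -- `q` lifts the zero coordinates to the free generator `ι 0`, which is not zero. Lifting them to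
  -- a genuine zero instead gives the same class and makes the ghost decomposition applicable.
  have h : ∀ j, (WLen.q (Pi.single j (a j)) : WLen p A n) =
      WLen.ofFree (Pi.single j (FreeAlgebra.ι ℤ (a j))) := by
    intro j
    rw [WLen.ofFree_eq_q]
    congr 1
    funext i
    rcases eq_or_ne i j with rfl | hij
    · simp [freeEval]
    · simp [hij]
  rw [Finset.sum_congr rfl fun j _ => h j]
  change QuotientAddGroup.mk' (ghostRel p A n) _ =
    ∑ j, QuotientAddGroup.mk' (ghostRel p A n) _
  rw [← map_sum]
  refine congrArg _ (Subtype.ext ?_)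
  rw [AddSubgroup.val_finsetSum]
  exact ghost_eq_sum_single p _

theorem HWitt.V_iterate_teich_apply (p : ℕ) [Fact p.Prime] {A : Type*} [Ring A] (k : ℕ) (a : A)
    (n : ℕ) : ((HWitt.V p A)^[k] (HWitt.teich p a)).1 n =
      WLen.q fun i : Fin n => if i.1 = k then a else 0 := by
  induction k with
  | zero => rfl
  | succ k ih =>
    rw [Function.iterate_succ_apply']
    change WLen.V p A n (((HWitt.V p A)^[k] (HWitt.teich p a)).1 n) = _
    rw [ih, WLen.V_q]
    congr 1
    funext i
    simp only [shiftRight]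
    by_cases hi : i.1 = 0
    · rw [if_pos hi, if_neg (by omega)]
    · rw [if_neg hi]
      exact if_congr (by omega) rfl rfl

theorem HWitt.apply_eq_of_le {p : ℕ} [Fact p.Prime] {A : Type*} [Ring A] {v w : HWitt p A}
    {m n : ℕ} (hmn : m ≤ n) (h : v.1 n = w.1 n) : v.1 m = w.1 m := by
  induction n, hmn using Nat.le_induction with
  | base => exact h
  | succ n _ ih => exact ih (by rw [← v.2 n, ← w.2 n, h])

/-- `W(A)` is topologically generated by the elements `V ^ n ⟨a⟩`. -/
theorem HWitt.dense_closure_gens (p : ℕ) [Fact p.Prime] (A : Type*) [Ring A] :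
    Dense (AddSubgroup.closure (HWitt.gens p A) : Set (HWitt p A)) := by
  intro w
  have hex : ∀ n, ∃ u ∈ AddSubgroup.closure (HWitt.gens p A), u.1 n = w.1 n := by
    intro n
    obtain ⟨a, ha⟩ := WLen.q_surjective (w.1 n)
    refine ⟨∑ j : Fin n, (HWitt.V p A)^[j] (HWitt.teich p (a j)),
      sum_mem fun j _ => AddSubgroup.subset_closure ⟨j, a j, rfl⟩, ?_⟩
    rw [← ha, WLen.q_eq_sum_single, AddSubgroup.val_finsetSum, Finset.sum_apply]
    refine Finset.sum_congr rfl fun j _ => ?_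
    rw [HWitt.V_iterate_teich_apply]
    congr 1
    funext i
    rw [Pi.single_apply]
    exact if_congr Fin.ext_iff.symm rfl rfl
  choose u hu hw using hex
  -- `u n` agrees with `w` at level `n`, hence at every lower level, so each coordinate of the
  -- sequence is eventually constant.
  refine mem_closure_of_tendsto (f := u) (b := Filter.atTop) ?_ (Filter.Eventually.of_forall hu)
  rw [tendsto_subtype_rng, tendsto_pi_nhds]
  intro m
  refine tendsto_const_nhds.congr' ?_
  filter_upwards [Filter.eventually_ge_atTop m] with n hn
  exact (HWitt.apply_eq_of_le hn (hw n)).symm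

/-- The Teichmüller map of `W(A)` does not depend on the order of the factors. -/
theorem HWitt.teich_mul_comm (p : ℕ) [Fact p.Prime] {A : Type*} [Ring A] (a b : A) :
    HWitt.teich p (a * b) = HWitt.teich p (b * a) := by
  refine Subtype.ext (funext fun n => ?_)
  -- The class does not depend on the chosen lift, so $cd$ may be lifted to a product of two
  -- generators instead of a single generator. Cyclic invariance of `tr` then becomes available.
  have h : ∀ c d : A, (HWitt.teich p (c * d)).1 n = WLen.ofFree
      (fun i : Fin n => if i.1 = 0 then FreeAlgebra.ι ℤ c * FreeAlgebra.ι ℤ d else 0) := by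
    intro c d
    rw [WLen.ofFree_eq_q]
    change WLen.q _ = _
    congr 1
    funext i
    by_cases hi : i.1 = 0 <;> simp [hi, freeEval]
  rw [h, h]
  refine congrArg (QuotientAddGroup.mk' (ghostRel p A n)) (Subtype.ext (funext fun i => ?_))
  change ghost p _ i = ghost p _ i
  rw [ghost_eq_sum_ghostGen, ghost_eq_sum_ghostGen]
  refine Finset.sum_congr rfl fun j _ => ?_
  by_cases hj : j.1 = 0
  · simp only [if_pos hj, ghostGen]
    split_ifs
    · congr 1
      generalize FreeAlgebra.ι ℤ a = x
      generalize FreeAlgebra.ι ℤ b = y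
      obtain ⟨m, hm⟩ := Nat.exists_eq_succ_of_ne_zero
        (pow_ne_zero (i.1 - j.1) (Fact.out : p.Prime).ne_zero)
      -- With a positive exponent $m+1$,
      -- $\mathrm{tr}((xy)^mxy)=\mathrm{tr}(y(xy)^mx)=\mathrm{tr}((yx)^myx)$.
      have hs : SemiconjBy y (x * y) (y * x) := (mul_assoc y x y).symm
      rw [hm, Nat.succ_eq_add_one, pow_succ, ← mul_assoc, tr_mul_comm, ← mul_assoc,
        (hs.pow_right m).eq, mul_assoc, ← pow_succ]
    · rfl
  · simp only [if_neg hj]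

/-! ### Continuous functionals on $HH_0(E(A))$. -/

open Polynomial

namespace Seq

theorem continuous_comp_apply {R M : Type*} [TopologicalSpace M] (g : R → M) (i : ℕ) :
    Continuous fun z : Seq R => g (z i) := by
  let _ : TopologicalSpace R := ⊥
  have : DiscreteTopology R := ⟨rfl⟩
  have h : Continuous fun x : Seq R => x i := continuous_apply (A := fun _ : ℕ => R) i
  exact (continuous_of_discreteTopology (f := g)).comp h

theorem isClosed_apply_mem {R : Type*} (S : Set R) (i : ℕ) : IsClosed {z : Seq R | z i ∈ S} := by
  let _ : TopologicalSpace R := ⊥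
  have : DiscreteTopology R := ⟨rfl⟩
  exact (isClosed_discrete S).preimage (continuous_comp_apply id i)

/-- A condition on the `i`-th component of the elements of `X(R)` may be checked on generators. -/
theorem apply_mem_of_mem_XSub (p : ℕ) {R : Type*} [Ring R] {T : Set R} (i : ℕ) (H : AddSubgroup R)
    (h : ∀ m ≤ i, ∀ l : List R, l ≠ [] → (∀ a ∈ l, a ∈ T) →
      (p : R) ^ m * (l.map fun a => a ^ p ^ (i - m)).prod ∈ H)
    {x : Seq R} (hx : x ∈ XSub p T) : x i ∈ H := by
  refine closure_minimal (t := {z : Seq R | z i ∈ H}) ?_ (isClosed_apply_mem (H : Set R) i) hx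
  refine (AddSubgroup.closure_le (H.comap (Pi.evalAddMonoidHom (fun _ : ℕ => R) i))).2 ?_
  rintro _ ⟨m, l, h1, h2, rfl⟩
  change (V p)^[m] _ i ∈ H
  rw [V_iterate_apply]
  split_ifs with hm
  · rw [prod_teich_apply]
    exact h m hm l h1 h2
  · exact zero_mem _

theorem VX_iterate_coe (p : ℕ) {R : Type*} [Ring R] (n : ℕ) (x : X p R) :
    ((VX p R)^[n] x).1 = (V p)^[n] x.1 := by
  induction n with
  | zero => rfl
  | succ n ih =>
    rw [Function.iterate_succ_apply', Function.iterate_succ_apply', ← ih]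
    rfl

end Seq

/-- Each generator of $X(I)$ is a product with at least one factor, and a positive power of an
element of $I$ maps to zero in $A$. -/
theorem monEval_apply_eq_zero_of_mem_XKer (p : ℕ) [hp : Fact p.Prime] {A : Type*} [Ring A]
    {x : Seq.X p (MonoidAlgebra ℤ A)} (hx : x ∈ XKer p A) (i : ℕ) : monEval A (x.1 i) = 0 := by
  refine Seq.apply_mem_of_mem_XSub p i (monEval A).toRingHom.toAddMonoidHom.ker ?_ hx
  intro m _ l hl h
  obtain ⟨a, l, rfl⟩ := List.exists_cons_of_ne_nil hl
  have ha : monEval A a = 0 := h a (by simp)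
  change monEval A _ = 0
  rw [List.map_cons, List.prod_cons, map_mul, map_mul, map_pow _ a, ha,
    zero_pow (pow_ne_zero _ hp.out.ne_zero), zero_mul, mul_zero]

/-- A continuous homomorphism on `X(ℤA)` which vanishes on `X(I)` and on the commutators induces a
continuous homomorphism on `HH₀(E(A))`. -/
theorem HH0.exists_lift (p : ℕ) {A : Type*} [Ring A] {M : Type*} [AddCommGroup M]
    [TopologicalSpace M] [T1Space M] (F : Seq.X p (MonoidAlgebra ℤ A) →+ M) (hF : Continuous F)
    (hker : ∀ x ∈ XKer p A, F x = 0) (hcomm : ∀ x y, F (x * y) = F (y * x)) :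
    ∃ G : HH0 p A →+ M, Continuous G ∧ ∀ x, G (HH0.proj p A (CDWitt.proj p A x)) = F x := by
  let F' : CDWitt p A →+ M := QuotientAddGroup.lift (XKer p A) F hker
  have hF' : Continuous F' := hF.quotient_lift _
  -- Points of `M` are closed, so the kernel is closed and contains the closure of the commutators
  -- as well.
  have hle : CDWitt.comm p A ≤ F'.ker := by
    refine AddSubgroup.topologicalClosure_minimal _ ?_ ?_
    · rw [AddSubgroup.closure_le]
      rintro _ ⟨x, y, rfl⟩
      change F (x * y - y * x) = 0
      rw [map_sub, hcomm, sub_self]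
    · exact isClosed_singleton.preimage hF'
  exact ⟨QuotientAddGroup.lift _ F' hle, hF'.quotient_lift _, fun _ => rfl⟩

theorem HH0.proj_V_iterate_teich (p : ℕ) {A : Type*} [Ring A] (n : ℕ) (a : A) :
    HH0.proj p A ((CDWitt.V p A)^[n] (CDWitt.teich p a)) = HH0.proj p A (CDWitt.proj p A
      ((Seq.VX p (MonoidAlgebra ℤ A))^[n] (CDWitt.teichX p a))) := by
  congr 1
  induction n with
  | zero => rfl
  | succ n ih =>
    rw [Function.iterate_succ_apply', Function.iterate_succ_apply', ih]
    rfl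

theorem CDWitt.coe_teichX_apply (p : ℕ) {A : Type*} [Ring A] (a : A) (i : ℕ) :
    monEval A ((CDWitt.teichX p a).1 i) = a ^ p ^ i := by
  change monEval A (MonoidAlgebra.of ℤ A a ^ p ^ i) = _
  rw [map_pow]
  congr 1
  simp [monEval]

/-- The homomorphism `x ↦ φ (ev x₀) + ψ (ev x₁)` on `X(ℤA)`. -/
noncomputable def ghostPairing (p : ℕ) {A : Type*} [Ring A] {M : Type*} [AddCommGroup M]
    (φ ψ : A →+ M) : Seq.X p (MonoidAlgebra ℤ A) →+ M where
  toFun x := φ (monEval A (x.1 0)) + ψ (monEval A (x.1 1))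
  map_zero' := by
    change φ (monEval A 0) + ψ (monEval A 0) = 0
    simp
  map_add' x y := by
    change φ (monEval A (x.1 0 + y.1 0)) + ψ (monEval A (x.1 1 + y.1 1)) = _
    simp only [map_add]
    abel

theorem ghostPairing_mul (p : ℕ) {A : Type*} [Ring A] {M : Type*} [AddCommGroup M]
    (φ ψ : A →+ M) (x y : Seq.X p (MonoidAlgebra ℤ A)) :
    ghostPairing p φ ψ (x * y) = φ (monEval A (x.1 0) * monEval A (y.1 0)) +
      ψ (monEval A (x.1 1) * monEval A (y.1 1)) := by
  rw [← map_mul, ← map_mul]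
  rfl

/-- The pairing reads only two discrete components, so it is continuous, and it vanishes on $X(I)$
because the components there map to zero in $A$. Only invariance under commutators has to be checked
in each application. -/
theorem ghostPairing_exists_lift (p : ℕ) [Fact p.Prime] {A : Type*} [Ring A] {M : Type*} [AddCommGroup M]
    [TopologicalSpace M] [DiscreteTopology M] (φ ψ : A →+ M)
    (hcomm : ∀ x y, ghostPairing p φ ψ (x * y) = ghostPairing p φ ψ (y * x)) :
    ∃ G : HH0 p A →+ M, Continuous G ∧
      ∀ x, G (HH0.proj p A (CDWitt.proj p A x)) = ghostPairing p φ ψ x := by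
  refine HH0.exists_lift p _ ?_ (fun x hx => ?_) hcomm
  · exact ((Seq.continuous_comp_apply (fun r => φ (monEval A r)) 0).comp
      continuous_subtype_val).add
      ((Seq.continuous_comp_apply (fun r => ψ (monEval A r)) 1).comp continuous_subtype_val)
  · change φ _ + ψ _ = 0
    rw [monEval_apply_eq_zero_of_mem_XKer p hx, monEval_apply_eq_zero_of_mem_XKer p hx, map_zero,
      map_zero, add_zero]

/-! ### The trace functional separating $\langle X\rangle\langle Y\rangle$ from the generators. -/

/-- This is $\mathrm{tr}(P^2)=\mathrm{tr}(P)^2-2\det P$ together with $t^2=t$ in $\mathbb F_2$. -/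
theorem trace_sq_of_charTwo (P : Matrix (Fin 2) (Fin 2) (ZMod 2)) : (P ^ 2).trace = P.trace := by
  have h : ∀ a b c d : ZMod 2, a * a + b * c + (c * b + d * d) = a + d := by decide
  rw [pow_two, Matrix.trace_fin_two, Matrix.trace_fin_two]
  simp only [Matrix.mul_apply, Fin.sum_univ_two]
  exact h _ _ _ _

/-- The representation `X ↦ E₀₁`, `Y ↦ s E₁₀` of `ℤ{X, Y}`. -/
noncomputable def matRep {K : Type*} [CommRing K] (s : K) :
    ZXY →ₐ[ℤ] Matrix (Fin 2) (Fin 2) K :=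
  FreeAlgebra.lift ℤ ![!![0, 1; 0, 0], !![0, 0; s, 0]]

theorem matRep_X {K : Type*} [CommRing K] (s : K) :
    matRep s (FreeAlgebra.ι ℤ 0) = !![0, 1; 0, 0] := by
  simp [matRep]

theorem matRep_Y {K : Type*} [CommRing K] (s : K) :
    matRep s (FreeAlgebra.ι ℤ 1) = !![0, 0; s, 0] := by
  simp [matRep]

/-- The composite of `matRep 1` with the trace. -/
noncomputable def traceRep : ZXY →+ ZMod 2 :=
  (Matrix.traceAddMonoidHom (Fin 2) (ZMod 2)).comp
    (matRep (1 : ZMod 2)).toRingHom.toAddMonoidHom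

theorem traceRep_apply (a : ZXY) : traceRep a = (matRep (1 : ZMod 2) a).trace := rfl

theorem traceRep_mul_comm (a b : ZXY) : traceRep (a * b) = traceRep (b * a) := by
  rw [traceRep_apply, traceRep_apply, map_mul, map_mul, Matrix.trace_mul_comm]

theorem traceRep_sq (a : ZXY) : traceRep (a ^ 2) = traceRep a := by
  rw [traceRep_apply, traceRep_apply, map_pow, trace_sq_of_charTwo]

theorem traceRep_two_mul (a : ZXY) : traceRep (2 * a) = 0 := by
  rw [two_mul, map_add, CharTwo.add_self_eq_zero]

/-- The class of `⟨X⟩⟨Y⟩` is not in the closure of the subgroup generated by the `π (V ^ n ⟨a⟩)`. -/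
theorem HH0.proj_teich_mul_teich_notMem_closure :
    HH0.proj 2 ZXY (CDWitt.proj 2 ZXY
        (CDWitt.teichX 2 (FreeAlgebra.ι ℤ (0 : Fin 2)) *
          CDWitt.teichX 2 (FreeAlgebra.ι ℤ (1 : Fin 2)))) ∉
        closure (AddSubgroup.closure (HH0.gens 2 ZXY) : Set (HH0 2 ZXY)) := by
  -- Adding the traces of both components makes them cancel on $\langle a\rangle$, whose components
  -- are $a$ and $a^2$.
  obtain ⟨G, hG, h⟩ := ghostPairing_exists_lift 2 traceRep traceRep fun x y => by
    rw [ghostPairing_mul, ghostPairing_mul, traceRep_mul_comm (monEval ZXY (x.1 0)),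
      traceRep_mul_comm (monEval ZXY (x.1 1))]
  intro hmem
  have hle : AddSubgroup.closure (HH0.gens 2 ZXY) ≤ G.ker := by
    rw [AddSubgroup.closure_le]
    rintro _ ⟨n, a, rfl⟩
    change G _ = 0
    rw [HH0.proj_V_iterate_teich, h]
    change traceRep (monEval ZXY (((Seq.VX 2 _)^[n] _).1 0)) +
      traceRep (monEval ZXY (((Seq.VX 2 _)^[n] _).1 1)) = 0
    rw [Seq.VX_iterate_coe, Seq.V_iterate_apply, Seq.V_iterate_apply]
    -- For $n=0$ the two traces cancel. For $n=1$ only the component $2a$ remains, which is zero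
    -- modulo 2. For $n\ge 2$ both components are zero.
    rcases n with _ | _ | n
    · simp only [le_refl, zero_le, if_true, pow_zero, one_mul, Nat.sub_zero]
      rw [CDWitt.coe_teichX_apply, CDWitt.coe_teichX_apply, pow_zero, pow_one, pow_one,
        traceRep_sq, CharTwo.add_self_eq_zero]
    · rw [if_neg (by omega), if_pos (by omega), map_zero, map_zero, zero_add, map_mul, Nat.cast_ofNat, zero_add,
        pow_one, map_ofNat, traceRep_two_mul]
    · rw [if_neg (by omega), if_neg (by omega)]
      simp
  have h0 := closure_minimal (t := (G.ker : Set (HH0 2 ZXY))) hle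
    (isClosed_singleton.preimage hG) hmem
  change G _ = 0 at h0
  rw [h, ghostPairing_mul] at h0
  simp only [CDWitt.coe_teichX_apply] at h0
  rw [traceRep_apply, traceRep_apply] at h0
  -- Here $XY\mapsto E_{00}$ has trace 1, while $X^2Y^2\mapsto 0$ since $E_{01}^2=0$.
  simp [matRep_X, matRep_Y, pow_two, Matrix.trace_fin_two] at h0

/-! ### Distinguishing $\langle XY\rangle$ from $\langle YX\rangle$ in $HH_0(E(A))$. -/

/-- The matrices over `K` which are scalar modulo `s` below and on the diagonal. -/
def triangularMod {K : Type*} [CommRing K] (s : K) : Subring (Matrix (Fin 2) (Fin 2) K) where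
  carrier := {P | s ∣ P 1 0 ∧ s ∣ P 0 0 - P 1 1}
  zero_mem' := by simp
  one_mem' := by simp
  add_mem' := by
    rintro P Q ⟨h1, h2⟩ ⟨h3, h4⟩
    refine ⟨dvd_add h1 h3, ?_⟩
    simpa [add_sub_add_comm] using dvd_add h2 h4
  neg_mem' := by
    rintro P ⟨h1, h2⟩
    refine ⟨(dvd_neg).2 h1, ?_⟩
    have := (dvd_neg).2 h2
    simpa [sub_eq_add_neg, add_comm] using this
  mul_mem' := by
    rintro P Q ⟨⟨a, ha⟩, ⟨b, hb⟩⟩ ⟨⟨c, hc⟩, ⟨d, hd⟩⟩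
    simp only [Set.mem_ofPred_eq, Matrix.mul_apply, Fin.sum_univ_two]
    exact ⟨⟨a * Q 0 0 + P 1 1 * c, by linear_combination Q 0 0 * ha + P 1 1 * hc⟩,
      ⟨b * Q 0 0 + P 1 1 * d + P 0 1 * c - a * Q 0 1, by
        linear_combination Q 0 0 * hb + P 1 1 * hd + P 0 1 * hc - Q 0 1 * ha⟩⟩

/-- Modulo $s$ the image of $Y$ vanishes, so the representation takes values in $K+KE_{01}$. -/
theorem matRep_mem_triangularMod {K : Type*} [CommRing K] (s : K) (a : ZXY) :
    matRep s a ∈ triangularMod s := by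
  induction a using FreeAlgebra.induction with
  | grade0 r =>
    rw [AlgHom.commutes, eq_intCast]
    exact intCast_mem _ r
  | grade1 i =>
    fin_cases i
    · change matRep s (FreeAlgebra.ι ℤ 0) ∈ _
      rw [matRep_X]
      constructor <;> simp
    · change matRep s (FreeAlgebra.ι ℤ 1) ∈ _
      rw [matRep_Y]
      constructor <;> simp
  | mul a b ha hb => rw [map_mul]; exact mul_mem ha hb
  | add a b ha hb => rw [map_add]; exact add_mem ha hb

/-- The matrices over `K` whose entries off the diagonal are divisible by `s` and by `s ^ 2`. -/
def offDiagMod {K : Type*} [CommRing K] (s : K) : Subring (Matrix (Fin 2) (Fin 2) K) where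
  carrier := {P | s ∣ P 0 1 ∧ s ^ 2 ∣ P 1 0}
  zero_mem' := by simp
  one_mem' := by simp
  add_mem' := fun h h' => ⟨dvd_add h.1 h'.1, dvd_add h.2 h'.2⟩
  neg_mem' := fun h => ⟨(dvd_neg).2 h.1, (dvd_neg).2 h.2⟩
  mul_mem' := by
    rintro P Q ⟨⟨a, ha⟩, ⟨b, hb⟩⟩ ⟨⟨c, hc⟩, ⟨d, hd⟩⟩
    simp only [Set.mem_ofPred_eq, Matrix.mul_apply, Fin.sum_univ_two]
    exact ⟨⟨P 0 0 * c + a * Q 1 1, by linear_combination P 0 0 * hc + Q 1 1 * ha⟩,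
      ⟨b * Q 0 0 + P 1 1 * d, by linear_combination Q 0 0 * hb + P 1 1 * hd⟩⟩

/-- The off-diagonal entries of $P^2$ are those of $P$ times the trace. In characteristic 2 the
trace equals $P_{00}-P_{11}$, which supplies one factor $s$; at $(1,0)$ the entry $P_{10}$ supplies
another. -/
theorem sq_mem_offDiagMod {K : Type*} [CommRing K] [CharP K 2] {s : K}
    {P : Matrix (Fin 2) (Fin 2) K} (hP : P ∈ triangularMod s) : P ^ 2 ∈ offDiagMod s := by
  obtain ⟨⟨a, ha⟩, ⟨b, hb⟩⟩ := hP
  have h2 : (2 : K) = 0 := CharTwo.two_eq_zero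
  rw [pow_two]
  change s ∣ (P * P) 0 1 ∧ s ^ 2 ∣ (P * P) 1 0
  simp only [Matrix.mul_apply, Fin.sum_univ_two]
  exact ⟨⟨P 0 1 * b, by linear_combination P 0 1 * hb + P 0 1 * P 1 1 * h2⟩,
    ⟨a * b, by linear_combination (P 0 0 - P 1 1) * ha + s * a * hb + P 1 0 * P 1 1 * h2⟩⟩

/-- The diagonal products cancel, leaving $P_{01}Q_{10}-Q_{01}P_{10}$, and each term is divisible by
$s\cdot s^2$. -/
theorem cube_dvd_commutator_apply {K : Type*} [CommRing K] {s : K}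
    {P Q : Matrix (Fin 2) (Fin 2) K} (hP : P ∈ offDiagMod s) (hQ : Q ∈ offDiagMod s) :
    s ^ 3 ∣ (P * Q) 0 0 - (Q * P) 0 0 := by
  obtain ⟨⟨a, ha⟩, ⟨b, hb⟩⟩ := hP
  obtain ⟨⟨c, hc⟩, ⟨d, hd⟩⟩ := hQ
  simp only [Matrix.mul_apply, Fin.sum_univ_two]
  refine ⟨a * d - b * c, ?_⟩
  rw [ha, hb, hc, hd]
  ring

/-- The components of index `1` of the elements of `X(ℤA)` map to `offDiagMod s`. -/
theorem matRep_ghost_one_mem_offDiagMod {K : Type*} [CommRing K] [CharP K 2] (s : K)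
    (x : Seq.X 2 (MonoidAlgebra ℤ ZXY)) :
    matRep s (monEval ZXY (x.1 1)) ∈ offDiagMod s := by
  refine Seq.apply_mem_of_mem_XSub 2 1 ((offDiagMod s).toAddSubgroup.comap
    ((matRep s).comp (monEval ZXY)).toRingHom.toAddMonoidHom) ?_ x.2
  intro m hm l _ _
  change matRep s (monEval ZXY _) ∈ offDiagMod s
  -- Component 1 of a generator is a product of squares for $m=0$, and twice something, hence zero
  -- in characteristic 2, for $m=1$.
  rcases m with _ | m
  · rw [pow_zero, one_mul, map_list_prod, map_list_prod]
    refine list_prod_mem fun P hP => ?_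
    simp only [List.map_map, List.mem_map] at hP
    obtain ⟨a, -, rfl⟩ := hP
    simp only [Function.comp, map_pow, Nat.sub_zero, pow_one]
    exact sq_mem_offDiagMod (matRep_mem_triangularMod s _)
  · obtain rfl : m = 0 := by omega
    have h2 : ((2 : ℕ) : Matrix (Fin 2) (Fin 2) K) = 0 := CharP.cast_eq_zero _ 2
    rw [zero_add, pow_one, map_mul, map_mul, map_natCast, map_natCast, h2, zero_mul]
    exact zero_mem _

/-- The coefficient of `s ^ 2` in the entry `(0, 0)` of `matRep s`. -/
noncomputable def entryRep : ZXY →+ ZMod 2 where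
  toFun a := (matRep (X : (ZMod 2)[X]) a 0 0).coeff 2
  map_zero' := by simp
  map_add' a b := by simp

/-- The Teichmüller map of `HH₀(E(A))` depends on the order of the factors. -/
theorem HH0.proj_teich_mul_ne :
    HH0.proj 2 ZXY (CDWitt.teich 2 (FreeAlgebra.ι ℤ (0 : Fin 2) * FreeAlgebra.ι ℤ (1 : Fin 2))) ≠
      HH0.proj 2 ZXY
        (CDWitt.teich 2 (FreeAlgebra.ι ℤ (1 : Fin 2) * FreeAlgebra.ι ℤ (0 : Fin 2))) := by
  -- The coefficient of $s^2$ lies just below the $s^3$ dividing all commutator entries, and it is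
  -- where $(XY)^2$ is visible.
  obtain ⟨G, -, h⟩ := ghostPairing_exists_lift 2 0 entryRep fun x y => by
    rw [ghostPairing_mul, ghostPairing_mul]
    congr 1
    have hd := cube_dvd_commutator_apply
      (matRep_ghost_one_mem_offDiagMod (X : (ZMod 2)[X]) x) (matRep_ghost_one_mem_offDiagMod X y)
    have h0 := X_pow_dvd_iff.1 hd 2 (by norm_num)
    rw [coeff_sub, sub_eq_zero, ← map_mul (matRep _), ← map_mul (matRep _)] at h0
    exact h0
  intro e
  have he := congrArg G e
  rw [CDWitt.teich, CDWitt.teich, h, h] at he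
  change 0 + (matRep (X : (ZMod 2)[X]) (monEval ZXY ((CDWitt.teichX 2 _).1 1)) 0 0).coeff 2 =
    0 + (matRep (X : (ZMod 2)[X]) (monEval ZXY ((CDWitt.teichX 2 _).1 1)) 0 0).coeff 2 at he
  rw [CDWitt.coe_teichX_apply, CDWitt.coe_teichX_apply] at he
  -- $XY\mapsto sE_{00}$ and $YX\mapsto sE_{11}$, so the squares have $(0,0)$ entries $s^2$ and $0$.
  simp [matRep_X, matRep_Y, pow_two] at he

end NCWitt

theorem theorem1 :
    -- (i) `W(A)` is topologically generated by the elements `V ^ n ⟨a⟩`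
    Dense (AddSubgroup.closure (NCWitt.HWitt.gens 2 NCWitt.ZXY) : Set (NCWitt.HWitt 2 NCWitt.ZXY)) ∧
    -- (ii) `HH₀(E(A))` is not; the class of `⟨X⟩⟨Y⟩` is not in the closure of the subgroup
    (¬ Dense (AddSubgroup.closure (NCWitt.HH0.gens 2 NCWitt.ZXY) : Set (NCWitt.HH0 2 NCWitt.ZXY)) ∧
      NCWitt.HH0.proj 2 NCWitt.ZXY (NCWitt.CDWitt.proj 2 NCWitt.ZXY
        (NCWitt.CDWitt.teichX 2 (FreeAlgebra.ι ℤ (0 : Fin 2)) *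
          NCWitt.CDWitt.teichX 2 (FreeAlgebra.ι ℤ (1 : Fin 2)))) ∉
        closure (AddSubgroup.closure (NCWitt.HH0.gens 2 NCWitt.ZXY) :
          Set (NCWitt.HH0 2 NCWitt.ZXY))) ∧
    -- (iii) no continuous surjection commutes with `V` and `⟨ ⟩`
    ¬ ∃ f : NCWitt.HWitt 2 NCWitt.ZXY → NCWitt.HH0 2 NCWitt.ZXY,
      Continuous f ∧ Function.Surjective f ∧ NCWitt.CommutesWithV 2 NCWitt.ZXY f ∧
        ∀ a : NCWitt.ZXY, f (NCWitt.HWitt.teich 2 a) =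
          NCWitt.HH0.proj 2 NCWitt.ZXY (NCWitt.CDWitt.teich 2 a) := by
  refine ⟨NCWitt.HWitt.dense_closure_gens 2 _,
    ⟨fun h => NCWitt.HH0.proj_teich_mul_teich_notMem_closure (h _),
      NCWitt.HH0.proj_teich_mul_teich_notMem_closure⟩, ?_⟩
  rintro ⟨f, -, -, -, hf⟩
  exact NCWitt.HH0.proj_teich_mul_ne (by rw [← hf, ← hf, NCWitt.HWitt.teich_mul_comm])
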